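/- Let $P=\{x\in\mathbf{R}^n : h_k(x)>c_k,\ k=1,\dots,m\}$ be a bounded non-empty open polytope, where the $h_k$ are linear forms with primitive integral coefficient vectors, $c_k\in\mathbf{R}$, and no inequality is redundant or repeated (for example the moment polytope of a compact polarised toric variety). Let $d\mu$ be Lebesgue measure on $P$, and let $d\sigma$ be the measure on $\partial P$ with $d\sigma\wedge dh_k=\pm d\mu$ on the facet $h_k=c_k$, that is, the Euclidean $(n-1)$-dimensional measure divided by $|\nabla h_k|$. Let $P^*$ be the union of $P$ and its (relatively open) codimension one faces, and $\mathcal{C}_1$ the set of continuous convex functions on $P^*$ that are integrable on $\partial P$ with respect to $d\sigma$. Put $\hat S=\mathrm{Vol}(\partial P,d\sigma)/\mathrm{Vol}(P,d\mu)$ and, for $A\in L^2(P)$ and $f\in\mathcal{C}_1\cap L^2(P)$, \[ \mathcal{L}_A(f)=\int_{\partial P} f\,d\sigma-\int_P Af\,d\mu,\qquad \mathcal{L}=\mathcal{L}_{\hat S},\qquad W(f)=\frac{\mathcal{L}(f)}{\|f\|_{L^2}}\quad (W(0)=0). \] Let \[ E=\{h\in L^2(P) : \mathcal{L}_h(f)\ge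 0 \text{ for all } f\in\mathcal{C}_1\cap L^2(P)\}. \] (1) Let $\Phi$ be the optimal destabilising convex function, i.e. a minimiser of $W$ over $\mathcal{C}_1\cap L^2(P)$, scaled so that $\mathcal{L}(\Phi)=-\|\Phi\|_{L^2}^2$. Then $B=\hat S-\Phi$ lies in $E$ and is the unique minimiser of the $L^2$ norm on $E$: $\|B\|_{L^2}<\|h\|_{L^2}$ for every $h\in E$ with $h\ne B$. (2) The set $E$ is non-empty and \[ \inf_{h\in E}\|h-\hat S\|_{L^2}=\sup\left\{\frac{-\mathcal{L}(f)}{\|f\|_{L^2}} : f\in\mathcal{C}_1\cap L^2(P),\ f\ne 0\right\}; \] in particular the supremum is finite. -/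

import Mathlib

open MeasureTheory
open scoped ENNReal

/-- A full-dimensional bounded polytope `{x | ∀ k, h_k(x) > c_k}` in `ℝⁿ`, where every linear form
`h_k` has a primitive integral coefficient vector and no inequality is redundant or repeated.
These include all moment polytopes of compact polarised toric varieties. -/
structure MomentPolytope (n : ℕ) where
  /-- number of facets -/
  m : ℕ
  /-- coefficient vector of `h_k` (inward normal of the `k`-th facet) -/
  normal : Fin m → Fin n → ℤ
  /-- the constants `c_k` -/
  c : Fin m → ℝ
  primitive : ∀ k, Finset.univ.gcd (normal k) = 1
  bounded : Bornology.IsBounded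
    {x : EuclideanSpace ℝ (Fin n) | ∀ k, c k < ∑ i, (normal k i : ℝ) * x i}
  nonempty : {x : EuclideanSpace ℝ (Fin n) | ∀ k, c k < ∑ i, (normal k i : ℝ) * x i}.Nonempty
  irredundant : ∀ k, ∃ x : EuclideanSpace ℝ (Fin n),
    ∑ i, (normal k i : ℝ) * x i = c k ∧ ∀ j, j ≠ k → c j < ∑ i, (normal j i : ℝ) * x i

namespace MomentPolytope

noncomputable section

variable {n : ℕ} (P : MomentPolytope n)

/-- The linear form `h_k`. -/
def form (k : Fin P.m) (x : EuclideanSpace ℝ (Fin n)) : ℝ := ∑ i, (P.normal k i : ℝ) * x i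

/-- The open polytope `P`. -/
def interior : Set (EuclideanSpace ℝ (Fin n)) := {x | ∀ k, P.c k < P.form k x}

/-- The (relatively open) `k`-th codimension one face of `P`. -/
def facet (k : Fin P.m) : Set (EuclideanSpace ℝ (Fin n)) :=
  {x | P.form k x = P.c k ∧ ∀ j, j ≠ k → P.c j < P.form j x}

/-- `P*`: the union of `P` and its codimension one faces. -/
def star : Set (EuclideanSpace ℝ (Fin n)) := P.interior ∪ ⋃ k, P.facet k

/-- `dμ`: Lebesgue measure on `P`. -/
def mu : Measure (EuclideanSpace ℝ (Fin n)) := volume.restrict P.interior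

/-- The canonical boundary measure `dσ`. On the face `h_k = c_k` the condition `dσ ∧ dh_k = ± dμ`
says that `dσ` is the Euclidean `(n-1)`-dimensional measure divided by the Euclidean length of the
gradient of `h_k`. Faces of codimension at least two are null. -/
def sigma : Measure (EuclideanSpace ℝ (Fin n)) :=
  ∑ k, ENNReal.ofReal ‖WithLp.toLp 2 (fun i => (P.normal k i : ℝ))‖⁻¹ •
    (μHE[n - 1] : Measure (EuclideanSpace ℝ (Fin n))).restrict (P.facet k)

/-- `Ŝ = Vol(∂P, dσ) / Vol(P, dμ)`. -/
def avgScalar : ℝ := (P.sigma Set.univ).toReal / (P.mu Set.univ).toReal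

/-- `𝒞₁`: continuous convex functions on `P*` that are integrable on `∂P`. -/
def C1 : Set (EuclideanSpace ℝ (Fin n) → ℝ) :=
  {f | ContinuousOn f P.star ∧ ConvexOn ℝ P.star f ∧ Integrable f P.sigma}

/-- `𝒞₁ ∩ L²(P)`. -/
def C1L2 : Set (EuclideanSpace ℝ (Fin n) → ℝ) := {f | f ∈ P.C1 ∧ MemLp f 2 P.mu}

/-- `𝓛_A(f) = ∫_{∂P} f dσ - ∫_P A f dμ`. -/
def LA (A f : EuclideanSpace ℝ (Fin n) → ℝ) : ℝ := ∫ x, f x ∂P.sigma - ∫ x, A x * f x ∂P.mu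

/-- `𝓛 = 𝓛_Ŝ`. -/
def L (f : EuclideanSpace ℝ (Fin n) → ℝ) : ℝ := P.LA (fun _ => P.avgScalar) f

/-- The `L²(P)` norm of a function in `L²(P)`. -/
def norm2 (f : EuclideanSpace ℝ (Fin n) → ℝ) : ℝ := (eLpNorm f 2 P.mu).toReal

/-- `W(f) = 𝓛(f) / ‖f‖`, which is `0` for `f = 0`. -/
def W (f : EuclideanSpace ℝ (Fin n) → ℝ) : ℝ := P.L f / P.norm2 f

/-- `Φ` is the optimal destabilising convex function: it minimises `W` over `𝒞₁ ∩ L²(P)`, and is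
scaled so that `𝓛(Φ) = -‖Φ‖²`. -/
structure IsOptimalDestabiliser (Φ : EuclideanSpace ℝ (Fin n) → ℝ) : Prop where
  mem : Φ ∈ P.C1L2
  isMin : ∀ f ∈ P.C1L2, P.W Φ ≤ P.W f
  scaling : P.L Φ = -(P.norm2 Φ) ^ 2

/-- `E ⊆ L²(P)`: all `h` with `𝓛_h(f) ≥ 0` for all convex `f`. -/
def E : Set (Lp ℝ 2 P.mu) := {h | ∀ f ∈ P.C1L2, 0 ≤ P.LA h f}

instance : IsFiniteMeasure P.mu :=
  isFiniteMeasure_restrict.2 (P.bounded.measure_lt_top (μ := volume)).ne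

/-- The constant `Ŝ` as an element of `L²(P)`. -/
def avgScalarLp : Lp ℝ 2 P.mu := Lp.const 2 P.mu P.avgScalar

end

end MomentPolytope

/-!
# Optimal destabilising convex functions and the minimum of the `L²` norm on `E`

For `f ∈ 𝒞₁ ∩ L²(P)` one has `𝓛_h(f) = 𝓛(f) - ⟪h - Ŝ, f⟫`, so `h ∈ E` means exactly that the linear
functional `⟪Ŝ - h, ·⟫` dominates `-𝓛` on the convex cone `𝒞₁ ∩ L²(P)` (`mem_E_iff`). The duality
between `inf ‖h - Ŝ‖` and `sup (-𝓛(f) / ‖f‖)` is then a Hahn-Banach sandwich: if `-𝓛 ≤ M ‖·‖` on the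
cone, some vector `g` with `‖g‖ ≤ M` satisfies `-𝓛 ≤ ⟪g, ·⟫` there, and `Ŝ - g` lies in `E`
(`exists_inner_bound_of_convex`, `exists_mem_E_norm_sub_le`). The opposite inequality is
Cauchy-Schwarz.

That the supremum is finite (`exists_neg_L_le`) comes from convexity: for `y` on a facet and `x ∈ P`,
`f y ≥ 2 f ((x + y) / 2) - f x`, and averaging over `x ∈ P` bounds `f` below on the boundary by a
multiple of its `L¹(P)` norm (`lower_bound_on_star`). Integration over the boundary uses that `dσ` is
finite, since each facet is a bounded piece of a hyperplane.

If `Φ` is an optimal destabiliser, then `-𝓛 ≤ ‖Φ‖ ‖·‖`, and the vector `g` given by the sandwich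
satisfies `‖g‖ ≤ ‖Φ‖` and `⟪g, Φ⟫ ≥ -𝓛(Φ) = ‖Φ‖²`, which forces `g = Φ`; hence `Ŝ - Φ ∈ E`. Testing
`h ∈ E` against the constants `±Ŝ`, on which `𝓛` vanishes, gives `‖h‖² = ‖h - Ŝ‖² + ‖Ŝ‖²`, and testing
it against `Φ` gives `‖h - Ŝ + Φ‖² ≤ ‖h - Ŝ‖² - ‖Φ‖²`. Together these are the strict minimality of
`Ŝ - Φ`.
-/

open scoped InnerProductSpace

/-! ### A sandwich theorem in Hilbert space -/

/-- Mazur-Orlicz sandwich for a norm: if a convex set of pairs (point, value) contains the origin and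
lies below the graph of `M ‖·‖`, it lies below the graph of a linear functional of norm at most
`M`. -/
theorem exists_inner_bound_of_convex {H : Type*} [NormedAddCommGroup H] [InnerProductSpace ℝ H]
    [CompleteSpace H] {S : Set (H × ℝ)} (hS : Convex ℝ S) (h0 : (0, 0) ∈ S) {M : ℝ} (hM0 : 0 ≤ M)
    (hM : ∀ p ∈ S, p.2 ≤ M * ‖p.1‖) :
    ∃ g : H, ‖g‖ ≤ M ∧ ∀ p ∈ S, p.2 ≤ ⟪g, p.1⟫_ℝ := by
  have hconv : Convex ℝ {p : H × ℝ | M * ‖p.1‖ < p.2} := by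
    intro p hp q hq a b ha hb hab
    simp only [Set.mem_ofPred_eq, Prod.fst_add, Prod.smul_fst, Prod.snd_add, Prod.smul_snd,
      smul_eq_mul] at *
    have h1 : ‖a • p.1 + b • q.1‖ ≤ a * ‖p.1‖ + b * ‖q.1‖ := by
      refine (norm_add_le _ _).trans ?_
      rw [norm_smul_of_nonneg ha, norm_smul_of_nonneg hb]
    have h2 := mul_le_mul_of_nonneg_left h1 hM0
    rcases ha.eq_or_lt with rfl | ha
    · obtain rfl : b = 1 := by linarith
      linarith
    · nlinarith [mul_lt_mul_of_pos_left hp ha, mul_le_mul_of_nonneg_left hq.le hb]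
  have hopen : IsOpen {p : H × ℝ | M * ‖p.1‖ < p.2} :=
    isOpen_lt (by fun_prop) (by fun_prop)
  have hdisj : Disjoint {p : H × ℝ | M * ‖p.1‖ < p.2} S :=
    Set.disjoint_left.2 fun p hp hpS => not_lt.2 (hM p hpS) hp
  -- A hyperplane separating the open epigraph of `M ‖·‖` from `S`. The epigraph accumulates at the
  -- origin, which lies in `S`, so the hyperplane passes through it.
  obtain ⟨φ, u, hφA, hφS⟩ := geometric_hahn_banach_open hconv hopen hS hdisj
  have hsplit : ∀ v r, φ (v, r) = φ (v, 0) + r * φ (0, 1) := by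
    intro v r
    rw [← smul_eq_mul, ← map_smul, ← map_add]
    simp
  have hu0 : u ≤ 0 := (hφS _ h0).trans_eq (map_zero φ)
  set c := φ (0, 1) with hc
  have hc0 : c < 0 := (hφA (0, 1) (by simp)).trans_le hu0
  have hu : u = 0 := by
    refine le_antisymm hu0 (le_of_forall_lt fun d hd => ?_)
    have := hφA (0, d / c) (by simpa using div_pos_of_neg_of_neg hd hc0)
    rw [hsplit, div_mul_cancel₀ _ hc0.ne] at this
    simpa [show φ (0, (0 : ℝ)) = 0 from map_zero φ] using this
  subst hu
  have hψ : ∀ v, φ (v, 0) ≤ -c * (M * ‖v‖) := by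
    intro v
    refine le_of_forall_pos_lt_add fun ε hε => ?_
    have := hφA (v, M * ‖v‖ + ε / -c)
      (by simpa using div_pos hε (neg_pos.2 hc0))
    rw [hsplit] at this
    have h2 : (M * ‖v‖ + ε / -c) * c = c * (M * ‖v‖) - ε := by
      have := hc0.ne
      field_simp
      ring
    linarith
  let ψ : StrongDual ℝ H := (-c)⁻¹ • φ.comp (ContinuousLinearMap.inl ℝ H ℝ)
  let g : H := (InnerProductSpace.toDual ℝ H).symm ψ
  have hg : ∀ v, ⟪g, v⟫_ℝ = (-c)⁻¹ * φ (v, 0) := fun v => by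
    rw [InnerProductSpace.toDual_symm_apply]
    simp [ψ]
  have hc' : 0 < -c := neg_pos.2 hc0
  refine ⟨g, ?_, fun p hp => ?_⟩
  · have h1 : ⟪g, g⟫_ℝ ≤ M * ‖g‖ := by
      rw [hg, inv_mul_le_iff₀ hc']
      exact hψ g
    rw [real_inner_self_eq_norm_sq] at h1
    by_contra! h
    nlinarith
  · have h1 := hφS p hp
    rw [show p = (p.1, p.2) from rfl, hsplit] at h1
    rw [hg, le_inv_mul_iff₀ hc']
    linarith

namespace MomentPolytope

noncomputable section

variable {n : ℕ} (P : MomentPolytope n)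

/-! ### Geometry of the polytope -/

theorem form_add_smul (k : Fin P.m) (a b : ℝ) (x y : EuclideanSpace ℝ (Fin n)) :
    P.form k (a • x + b • y) = a * P.form k x + b * P.form k y := by
  simp only [form, PiLp.add_apply, PiLp.smul_apply, smul_eq_mul, Finset.mul_sum,
    ← Finset.sum_add_distrib]
  exact Finset.sum_congr rfl fun i _ => by ring

theorem continuous_form (k : Fin P.m) : Continuous (P.form k) := by
  unfold form; fun_prop

theorem isOpen_interior : IsOpen P.interior := by
  simp only [interior, Set.ofPred_forall]
  exact isOpen_iInter_of_finite fun k => isOpen_lt continuous_const (P.continuous_form k)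

theorem measurableSet_interior : MeasurableSet P.interior := P.isOpen_interior.measurableSet

theorem measurableSet_facet (k : Fin P.m) : MeasurableSet (P.facet k) := by
  have h : P.facet k = {x | P.form k x = P.c k} ∩ ⋂ j, ⋂ _ : j ≠ k, {x | P.c j < P.form j x} := by
    ext x; simp [facet]
  rw [h]
  exact (isClosed_eq (P.continuous_form k) continuous_const).measurableSet.inter
    (.iInter fun j => .iInter fun _ =>
      (isOpen_lt continuous_const (P.continuous_form j)).measurableSet)

theorem le_form_of_mem_star {x : EuclideanSpace ℝ (Fin n)} (hx : x ∈ P.star) (k : Fin P.m) :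
    P.c k ≤ P.form k x := by
  rcases hx with hx | hx
  · exact (hx k).le
  · obtain ⟨j, hj⟩ := Set.mem_iUnion.1 hx
    by_cases h : k = j
    · subst h; exact hj.1.ge
    · exact (hj.2 k h).le

theorem mem_facet_of_mem_star {x : EuclideanSpace ℝ (Fin n)} (hx : x ∈ P.star) {k : Fin P.m}
    (hk : P.form k x = P.c k) : x ∈ P.facet k := by
  rcases hx with hx | hx
  · exact absurd hk (hx k).ne'
  · obtain ⟨j, hj⟩ := Set.mem_iUnion.1 hx
    by_cases h : k = j
    · subst h; exact hj
    · exact absurd hk (hj.2 k h).ne'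

theorem interior_subset_star : P.interior ⊆ P.star := Set.subset_union_left

theorem facet_subset_star (k : Fin P.m) : P.facet k ⊆ P.star :=
  (Set.subset_iUnion _ k).trans Set.subset_union_right

/-- A proper convex combination of a point of `P` and a point of `P*` lies in `P`. -/
theorem combo_mem_interior {x y : EuclideanSpace ℝ (Fin n)} (hx : x ∈ P.interior) (hy : y ∈ P.star)
    {a b : ℝ} (ha : 0 < a) (hb : 0 ≤ b) (hab : a + b = 1) : a • x + b • y ∈ P.interior := by
  intro k
  rw [form_add_smul]
  have h1 := mul_lt_mul_of_pos_left (hx k) ha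
  have h2 := mul_le_mul_of_nonneg_left (P.le_form_of_mem_star hy k) hb
  calc P.c k = a * P.c k + b * P.c k := by rw [← add_mul, hab, one_mul]
    _ < _ := by linarith

theorem convex_star : Convex ℝ P.star := by
  rw [convex_iff_forall_pos]
  intro x hx y hy a b ha hb hab
  by_cases hz : a • x + b • y ∈ P.interior
  · exact P.interior_subset_star hz
  simp only [interior, Set.mem_ofPred_eq, not_forall, not_lt] at hz
  obtain ⟨k, hk⟩ := hz
  rw [form_add_smul] at hk
  -- A form attaining its minimum on the polytope at an interior point of a segment does so at
  -- both endpoints.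
  have hc : P.c k = a * P.c k + b * P.c k := by rw [← add_mul, hab, one_mul]
  have hxk := P.le_form_of_mem_star hx k
  have hyk := P.le_form_of_mem_star hy k
  have hx' : P.form k x = P.c k := by nlinarith
  have hy' : P.form k y = P.c k := by nlinarith
  refine P.facet_subset_star k ⟨?_, fun j hj => ?_⟩
  · rw [form_add_smul, hx', hy', ← hc]
  · have h1 := mul_lt_mul_of_pos_left ((P.mem_facet_of_mem_star hx hx').2 j hj) ha
    have h2 := mul_lt_mul_of_pos_left ((P.mem_facet_of_mem_star hy hy').2 j hj) hb
    rw [form_add_smul]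
    calc P.c j = a * P.c j + b * P.c j := by rw [← add_mul, hab, one_mul]
      _ < _ := by linarith

theorem star_subset_closure_interior : P.star ⊆ closure P.interior := by
  intro y hy
  obtain ⟨x, hx⟩ : P.interior.Nonempty := P.nonempty
  have ht : Filter.Tendsto (fun t : ℝ => t • x + (1 - t) • y) (nhdsWithin 0 (Set.Ioi 0))
      (nhds y) := by
    have : Continuous fun t : ℝ => t • x + (1 - t) • y := by fun_prop
    simpa using (this.tendsto 0).mono_left nhdsWithin_le_nhds
  refine mem_closure_of_tendsto ht ?_
  filter_upwards [Ioo_mem_nhdsGT (zero_lt_one' ℝ)] with t ht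
  exact P.combo_mem_interior hx hy ht.1 (by linarith [ht.2]) (by ring)

theorem isBounded_interior : Bornology.IsBounded P.interior := P.bounded

/-! ### Finiteness of the boundary measure -/

theorem measure_interior_pos : 0 < volume P.interior :=
  P.isOpen_interior.measure_pos _ P.nonempty

theorem mu_univ_toReal_pos : 0 < (P.mu Set.univ).toReal := by
  refine ENNReal.toReal_pos ?_ (measure_ne_top _ _)
  simpa [mu] using P.measure_interior_pos.ne'

theorem form_eq_inner (k : Fin P.m) (x : EuclideanSpace ℝ (Fin n)) :
    P.form k x =
      ⟪(WithLp.toLp 2 (fun i => (P.normal k i : ℝ)) : EuclideanSpace ℝ (Fin n)), x⟫_ℝ := by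
  simp [form, PiLp.inner_apply, mul_comm]

theorem normal_ne_zero (k : Fin P.m) :
    (WithLp.toLp 2 (fun i => (P.normal k i : ℝ)) : EuclideanSpace ℝ (Fin n)) ≠ 0 := by
  intro h
  have h0 : ∀ i, P.normal k i = 0 := fun i => by
    have := congrArg (fun v : EuclideanSpace ℝ (Fin n) => v i) h
    simpa using this
  have := P.primitive k
  rw [Finset.gcd_eq_zero_iff.2 fun i _ => h0 i] at this
  exact zero_ne_one this

/-- A facet is the isometric image of a bounded subset of the `(n - 1)`-dimensional orthogonal
complement of its normal vector, where `μHE[n - 1]` is Lebesgue measure. -/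
theorem hausdorff_facet_lt_top (k : Fin P.m) :
    (μHE[n - 1] : Measure (EuclideanSpace ℝ (Fin n))) (P.facet k) < ∞ := by
  set v : EuclideanSpace ℝ (Fin n) := WithLp.toLp 2 (fun i => (P.normal k i : ℝ)) with hv
  have hv0 : v ≠ 0 := P.normal_ne_zero k
  obtain ⟨p, hp, -⟩ : (P.facet k).Nonempty := P.irredundant k
  have hrank : Module.finrank ℝ (ℝ ∙ v)ᗮ = n - 1 := by
    have h1 := (ℝ ∙ v).finrank_add_finrank_orthogonal
    rw [finrank_span_singleton hv0, finrank_euclideanSpace_fin] at h1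
    omega
  let ι : (ℝ ∙ v)ᗮ → EuclideanSpace ℝ (Fin n) := fun w => w + p
  have hι : Isometry ι := (isometry_add_right p).comp isometry_subtype_coe
  have hsub : P.facet k ⊆ ι '' (ι ⁻¹' P.facet k) := by
    intro x hx
    have hxp : x - p ∈ (ℝ ∙ v)ᗮ := by
      rw [Submodule.mem_orthogonal_singleton_iff_inner_right, inner_sub_right, hv, ← form_eq_inner,
        ← form_eq_inner, hx.1]
      exact sub_eq_zero.2 hp.symm
    exact ⟨⟨x - p, hxp⟩, by simpa [ι] using hx, by simp [ι]⟩
  have hbdd : Bornology.IsBounded (ι ⁻¹' P.facet k) :=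
    hι.antilipschitz.isBounded_preimage (P.isBounded_interior.closure.subset
      ((P.facet_subset_star k).trans P.star_subset_closure_interior))
  calc (μHE[n - 1] : Measure (EuclideanSpace ℝ (Fin n))) (P.facet k)
      ≤ μHE[n - 1] (ι '' (ι ⁻¹' P.facet k)) := measure_mono hsub
    _ = volume (ι ⁻¹' P.facet k) := by
      rw [hι.euclideanHausdorffMeasure_image, ← hrank,
        InnerProductSpace.euclideanHausdorffMeasure_eq_volume]
    _ < ∞ := hbdd.measure_lt_top

instance : IsFiniteMeasure P.sigma := by
  refine ⟨?_⟩
  simp only [sigma, Measure.coe_finsetSum, Finset.sum_apply, Measure.smul_apply, smul_eq_mul,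
    Measure.restrict_apply_univ]
  exact ENNReal.sum_lt_top.2 fun k _ =>
    ENNReal.mul_lt_top ENNReal.ofReal_lt_top (P.hausdorff_facet_lt_top k)

theorem ae_sigma_mem_star : ∀ᵐ x ∂P.sigma, x ∈ P.star := by
  rw [sigma, ae_finsetSum_measure_iff]
  exact fun k _ => Measure.ae_smul_measure ((ae_restrict_mem (P.measurableSet_facet k)).mono
    fun x hx => P.facet_subset_star k hx) _

/-! ### The lower bound for convex functions on the boundary -/

/-- Averaging `f y ≥ 2 f ((x + y) / 2) - f x` over `x ∈ P`: the substitution `x ↦ (x + y) / 2`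
scales volume by `2⁻ⁿ`, whence the constant `2 * 2 ^ n + 1`. -/
theorem lower_bound_on_star {f : EuclideanSpace ℝ (Fin n) → ℝ} (hconv : ConvexOn ℝ P.star f)
    (hint : Integrable f P.mu) {y : EuclideanSpace ℝ (Fin n)} (hy : y ∈ P.star) :
    -((2 ^ (n + 1) + 1) * ∫ x, |f x| ∂P.mu) ≤ (P.mu Set.univ).toReal * f y := by
  set G : EuclideanSpace ℝ (Fin n) → ℝ := P.interior.indicator fun x => |f x| with hGdef
  have hG : Integrable G := (integrable_indicator_iff P.measurableSet_interior).2 hint.abs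
  have hGint : ∫ x, G x = ∫ x, |f x| ∂P.mu := integral_indicator P.measurableSet_interior
  have hG0 : ∀ x, 0 ≤ G x := Set.indicator_nonneg fun _ _ => abs_nonneg _
  have hH : Integrable fun x => G ((2⁻¹ : ℝ) • (x + y)) :=
    (hG.comp_smul (R := (2⁻¹ : ℝ)) (by norm_num)).comp_add_right y
  have hHint : ∫ x, G ((2⁻¹ : ℝ) • (x + y)) = 2 ^ n * ∫ x, G x := by
    rw [integral_add_right_eq_self (fun x => G ((2⁻¹ : ℝ) • x)) y, Measure.integral_comp_smul]
    simp
  have hpt : ∀ x ∈ P.interior, -(2 * G ((2⁻¹ : ℝ) • (x + y)) + G x) ≤ f y := by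
    intro x hx
    have hz := P.combo_mem_interior hx hy (a := 2⁻¹) (b := 2⁻¹) (by norm_num) (by norm_num)
      (by norm_num)
    have h1 := hconv.2 (P.interior_subset_star hx) hy (show (0 : ℝ) ≤ 2⁻¹ by norm_num)
      (show (0 : ℝ) ≤ 2⁻¹ by norm_num) (by norm_num)
    rw [← smul_add] at hz h1
    rw [hGdef, Set.indicator_of_mem hx, Set.indicator_of_mem hz]
    simp only [smul_eq_mul] at h1
    linarith [neg_abs_le (f ((2⁻¹ : ℝ) • (x + y))), le_abs_self (f x)]
  have hsum : Integrable fun x => 2 * G ((2⁻¹ : ℝ) • (x + y)) + G x := (hH.const_mul 2).add hG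
  calc -((2 ^ (n + 1) + 1) * ∫ x, |f x| ∂P.mu)
      = -∫ x, (2 * G ((2⁻¹ : ℝ) • (x + y)) + G x) := by
        rw [integral_add (hH.const_mul 2) hG, integral_const_mul, hHint, hGint]; ring
    _ ≤ -∫ x in P.interior, (2 * G ((2⁻¹ : ℝ) • (x + y)) + G x) :=
        neg_le_neg (setIntegral_le_integral hsum (.of_forall fun x => by
          have := hG0 ((2⁻¹ : ℝ) • (x + y)); have := hG0 x; simp only [Pi.zero_apply]; positivity))
    _ = ∫ x in P.interior, -(2 * G ((2⁻¹ : ℝ) • (x + y)) + G x) := (integral_neg _).symm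
    _ ≤ ∫ _ in P.interior, f y :=
        setIntegral_mono_on hsum.neg.integrableOn
          (integrable_const (μ := P.mu) (f y)) P.measurableSet_interior hpt
    _ = (P.mu Set.univ).toReal * f y := by
        simp [mu, Measure.real]

/-! ### The functional `𝓛` on the cone of convex functions -/

theorem norm_toLp_eq {f : EuclideanSpace ℝ (Fin n) → ℝ} (hf : MemLp f 2 P.mu) :
    ‖hf.toLp f‖ = P.norm2 f := Lp.norm_toLp f hf

theorem norm2_nonneg (f : EuclideanSpace ℝ (Fin n) → ℝ) : 0 ≤ P.norm2 f := ENNReal.toReal_nonneg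

theorem LA_eq_sub_inner (h : Lp ℝ 2 P.mu) {f : EuclideanSpace ℝ (Fin n) → ℝ}
    (hf : MemLp f 2 P.mu) : P.LA h f = ∫ x, f x ∂P.sigma - ⟪h, hf.toLp f⟫_ℝ := by
  rw [LA, L2.inner_def]
  congr 1
  refine integral_congr_ae ?_
  filter_upwards [hf.coeFn_toLp] with x hx
  simp [hx, mul_comm]

theorem L_eq_LA_avgScalarLp (f : EuclideanSpace ℝ (Fin n) → ℝ) :
    P.L f = P.LA P.avgScalarLp f := by
  rw [L, LA, LA]
  congr 1
  refine integral_congr_ae ?_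
  filter_upwards [Lp.coeFn_const (p := 2) (μ := P.mu) P.avgScalar] with x hx
  rw [avgScalarLp, hx, Function.const]

theorem LA_eq_L_sub_inner (h : Lp ℝ 2 P.mu) {f : EuclideanSpace ℝ (Fin n) → ℝ}
    (hf : MemLp f 2 P.mu) : P.LA h f = P.L f - ⟪h - P.avgScalarLp, hf.toLp f⟫_ℝ := by
  rw [L_eq_LA_avgScalarLp, P.LA_eq_sub_inner _ hf, P.LA_eq_sub_inner _ hf, inner_sub_left]
  ring

theorem mem_E_iff {h : Lp ℝ 2 P.mu} : h ∈ P.E ↔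
    ∀ f (hf : f ∈ P.C1L2), ⟪h - P.avgScalarLp, hf.2.toLp f⟫_ℝ ≤ P.L f :=
  forall₂_congr fun f hf => by rw [P.LA_eq_L_sub_inner h hf.2, sub_nonneg]

theorem const_mem_C1L2 (c : ℝ) : (fun _ => c) ∈ P.C1L2 :=
  ⟨⟨continuousOn_const, convexOn_const c P.convex_star, integrable_const c⟩, memLp_const c⟩

theorem L_const (c : ℝ) : P.L (fun _ => c) = 0 := by
  have := P.mu_univ_toReal_pos.ne'
  simp only [L, LA, integral_const, avgScalar, smul_eq_mul, Measure.real]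
  field_simp
  ring

theorem combo_mem_C1L2 {f g : EuclideanSpace ℝ (Fin n) → ℝ} (hf : f ∈ P.C1L2) (hg : g ∈ P.C1L2)
    {a b : ℝ} (ha : 0 ≤ a) (hb : 0 ≤ b) : a • f + b • g ∈ P.C1L2 :=
  ⟨⟨(hf.1.1.const_smul a).add (hg.1.1.const_smul b),
    (hf.1.2.1.smul ha).add (hg.1.2.1.smul hb),
    (hf.1.2.2.smul a).add (hg.1.2.2.smul b)⟩, (hf.2.const_smul a).add (hg.2.const_smul b)⟩

theorem L_combo {f g : EuclideanSpace ℝ (Fin n) → ℝ} (hf : f ∈ P.C1L2) (hg : g ∈ P.C1L2)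
    (a b : ℝ) : P.L (a • f + b • g) = a * P.L f + b * P.L g := by
  have hfμ : Integrable f P.mu := hf.2.integrable one_le_two
  have hgμ : Integrable g P.mu := hg.2.integrable one_le_two
  simp only [L, LA, integral_const_mul]
  rw [integral_add' (hf.1.2.2.smul a) (hg.1.2.2.smul b), integral_add' (hfμ.smul a) (hgμ.smul b)]
  simp only [Pi.smul_apply, smul_eq_mul, integral_const_mul]
  ring

theorem integral_abs_le {f : EuclideanSpace ℝ (Fin n) → ℝ} (hf : MemLp f 2 P.mu) :
    ∫ x, |f x| ∂P.mu ≤ P.norm2 (fun _ => 1) * P.norm2 f := by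
  have h1 : MemLp (fun _ : EuclideanSpace ℝ (Fin n) => (1 : ℝ)) 2 P.mu := memLp_const 1
  have h2 : MemLp (fun x => |f x|) 2 P.mu := hf.abs
  have h3 : P.norm2 (fun x => |f x|) = P.norm2 f := congrArg ENNReal.toReal (eLpNorm_norm f)
  calc ∫ x, |f x| ∂P.mu = ⟪h1.toLp _, h2.toLp _⟫_ℝ := by
        rw [L2.inner_def]
        refine integral_congr_ae ?_
        filter_upwards [h1.coeFn_toLp, h2.coeFn_toLp] with x hx1 hx2
        rw [hx1, hx2]
        simp
    _ ≤ ‖h1.toLp _‖ * ‖h2.toLp _‖ := real_inner_le_norm _ _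
    _ = _ := by rw [norm_toLp_eq, norm_toLp_eq, h3]

/-- `-𝓛(f) / ‖f‖` is bounded above on `𝒞₁ ∩ L²(P)`. The bound also covers `‖f‖ = 0`, where it says
that `𝓛(f) ≥ 0`. -/
theorem exists_neg_L_le : ∃ M, 0 ≤ M ∧ ∀ f ∈ P.C1L2, -P.L f ≤ M * P.norm2 f := by
  set V := (P.mu Set.univ).toReal with hV
  have hV0 : 0 < V := P.mu_univ_toReal_pos
  set K : ℝ := P.sigma.real Set.univ * ((2 ^ (n + 1) + 1) / V) + |P.avgScalar| with hK
  have hK0 : 0 ≤ K := by positivity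
  refine ⟨K * P.norm2 fun _ => 1, mul_nonneg hK0 (P.norm2_nonneg _), fun f hf => ?_⟩
  set I := ∫ x, |f x| ∂P.mu with hI
  have hfμ : Integrable f P.mu := hf.2.integrable one_le_two
  have hbd : ∀ᵐ x ∂P.sigma, -((2 ^ (n + 1) + 1) / V * I) ≤ f x := by
    filter_upwards [P.ae_sigma_mem_star] with x hx
    have := P.lower_bound_on_star hf.1.2.1 hfμ hx
    rw [div_mul_eq_mul_div, ← neg_div, div_le_iff₀ hV0]
    linarith
  have hσ : -(P.sigma.real Set.univ * ((2 ^ (n + 1) + 1) / V) * I) ≤ ∫ x, f x ∂P.sigma := by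
    have := integral_mono_ae (integrable_const _) hf.1.2.2 hbd
    simp only [integral_const, smul_eq_mul] at this
    linarith
  have hμ : ∫ x, P.avgScalar * f x ∂P.mu ≤ |P.avgScalar| * I := by
    rw [integral_const_mul]
    refine (le_abs_self _).trans ?_
    rw [abs_mul]
    exact mul_le_mul_of_nonneg_left abs_integral_le_integral_abs (abs_nonneg _)
  calc -P.L f ≤ K * I := by rw [L, LA, hK]; linarith
    _ ≤ K * (P.norm2 (fun _ => 1) * P.norm2 f) :=
        mul_le_mul_of_nonneg_left (P.integral_abs_le hf.2) hK0
    _ = _ := by ring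

/-! ### Duality -/

/-- A bound for `-𝓛` by `M ‖·‖` is realised by an element of `E` at distance at most `M` from
`Ŝ`. -/
theorem exists_mem_E_norm_sub_le {M : ℝ} (hM0 : 0 ≤ M)
    (hM : ∀ f ∈ P.C1L2, -P.L f ≤ M * P.norm2 f) :
    ∃ h ∈ P.E, ‖P.avgScalarLp - h‖ ≤ M := by
  let S : Set (Lp ℝ 2 P.mu × ℝ) := {p | ∃ f, ∃ hf : f ∈ P.C1L2, p = (hf.2.toLp f, -P.L f)}
  have hS : Convex ℝ S := by
    rintro _ ⟨f, hf, rfl⟩ _ ⟨g, hg, rfl⟩ a b ha hb -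
    refine ⟨_, P.combo_mem_C1L2 hf hg ha hb, ?_⟩
    rw [P.L_combo hf hg]
    refine Prod.ext rfl ?_
    simp only [Prod.snd_add, Prod.smul_snd, smul_eq_mul]
    ring
  have h0 : ((0 : Lp ℝ 2 P.mu), (0 : ℝ)) ∈ S :=
    ⟨_, P.const_mem_C1L2 0, by rw [L_const, neg_zero]; rfl⟩
  obtain ⟨g, hg, hgS⟩ := exists_inner_bound_of_convex hS h0 hM0 (by
    rintro _ ⟨f, hf, rfl⟩
    simpa only [norm_toLp_eq] using hM f hf)
  refine ⟨P.avgScalarLp - g, P.mem_E_iff.2 fun f hf => ?_, by simpa using hg⟩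
  have := hgS _ ⟨f, hf, rfl⟩
  simp only [sub_sub_cancel_left, inner_neg_left]
  linarith

theorem neg_L_le_of_mem_E {h : Lp ℝ 2 P.mu} (hh : h ∈ P.E)
    {f : EuclideanSpace ℝ (Fin n) → ℝ} (hf : f ∈ P.C1L2) :
    -P.L f ≤ ‖P.avgScalarLp - h‖ * P.norm2 f := by
  have h1 := P.mem_E_iff.1 hh f hf
  have h2 := real_inner_le_norm (P.avgScalarLp - h) (hf.2.toLp f)
  rw [norm_toLp_eq] at h2
  rw [← neg_sub, inner_neg_left] at h1
  linarith

theorem L_nonneg_of_norm2_eq_zero {f : EuclideanSpace ℝ (Fin n) → ℝ} (hf : f ∈ P.C1L2)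
    (h0 : P.norm2 f = 0) : 0 ≤ P.L f := by
  obtain ⟨M, -, hM⟩ := P.exists_neg_L_le
  have := hM f hf
  rw [h0, mul_zero] at this
  linarith

theorem neg_L_le_of_ratio_le {M : ℝ} (hM : ∀ f ∈ P.C1L2, P.norm2 f ≠ 0 → -P.L f / P.norm2 f ≤ M)
    {f : EuclideanSpace ℝ (Fin n) → ℝ} (hf : f ∈ P.C1L2) : -P.L f ≤ M * P.norm2 f := by
  by_cases h0 : P.norm2 f = 0
  · rw [h0, mul_zero]
    linarith [P.L_nonneg_of_norm2_eq_zero hf h0]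
  · exact (div_le_iff₀ ((P.norm2_nonneg f).lt_of_ne' h0)).1 (hM f hf h0)

/-- The constants `±Ŝ` are both convex and `𝓛` vanishes on them, so `h - Ŝ` is orthogonal to
`Ŝ`. -/
theorem inner_sub_avgScalarLp_of_mem_E {h : Lp ℝ 2 P.mu} (hh : h ∈ P.E) :
    ⟪h - P.avgScalarLp, P.avgScalarLp⟫_ℝ = 0 := by
  have key : ∀ c : ℝ, ⟪h - P.avgScalarLp, Lp.const 2 P.mu c⟫_ℝ ≤ 0 := fun c =>
    (P.mem_E_iff.1 hh _ (P.const_mem_C1L2 c)).trans_eq (P.L_const c)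
  refine le_antisymm (key _) ?_
  have := key (-P.avgScalar)
  rw [map_neg, inner_neg_right] at this
  exact neg_nonpos.1 this

theorem norm_sq_of_mem_E {h : Lp ℝ 2 P.mu} (hh : h ∈ P.E) :
    ‖h‖ ^ 2 = ‖h - P.avgScalarLp‖ ^ 2 + ‖P.avgScalarLp‖ ^ 2 := by
  conv_lhs => rw [← sub_add_cancel h P.avgScalarLp]
  rw [norm_add_sq_real, P.inner_sub_avgScalarLp_of_mem_E hh]
  ring

/-! ### Optimal destabilisers -/

/-- The element of `E` at distance at most `‖Φ‖` from `Ŝ` must be `Ŝ - Φ`, by the equality case of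
Cauchy-Schwarz. -/
theorem IsOptimalDestabiliser.sub_mem_E {P : MomentPolytope n}
    {Φ : EuclideanSpace ℝ (Fin n) → ℝ} (hΦ : P.IsOptimalDestabiliser Φ) :
    P.avgScalarLp - hΦ.mem.2.toLp Φ ∈ P.E := by
  set N := P.norm2 Φ with hN
  set φ := hΦ.mem.2.toLp Φ with hφ
  have hφN : ‖φ‖ = N := P.norm_toLp_eq _
  -- If `N = 0`, both sides vanish since division by zero gives zero.
  have hW : P.W Φ = -N := by
    rw [W, hΦ.scaling, ← hN, neg_div, sq, mul_self_div_self]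
  obtain ⟨h, hh, hhN⟩ := P.exists_mem_E_norm_sub_le (P.norm2_nonneg Φ) fun f hf =>
    P.neg_L_le_of_ratio_le (fun f hf _ => by
      have := hΦ.isMin f hf
      rw [hW, W] at this
      rw [neg_div]
      linarith) hf
  have h1 : N ^ 2 ≤ ⟪P.avgScalarLp - h, φ⟫_ℝ := by
    have := P.mem_E_iff.1 hh Φ hΦ.mem
    rw [hΦ.scaling, ← hN, ← neg_sub, inner_neg_left] at this
    linarith
  have h2 : ‖P.avgScalarLp - h - φ‖ ^ 2 ≤ 0 := by
    rw [norm_sub_sq_real, hφN]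
    have : ‖P.avgScalarLp - h‖ ^ 2 ≤ N ^ 2 := pow_le_pow_left₀ (norm_nonneg _) hhN 2
    linarith
  have h3 : P.avgScalarLp - h - φ = 0 := by
    simpa using h2.antisymm (sq_nonneg _)
  have h4 : P.avgScalarLp - φ = h := by
    rw [sub_eq_zero] at h3
    rw [← h3, sub_sub_cancel]
  rwa [h4]

theorem IsOptimalDestabiliser.norm_lt {P : MomentPolytope n}
    {Φ : EuclideanSpace ℝ (Fin n) → ℝ} (hΦ : P.IsOptimalDestabiliser Φ) {h : Lp ℝ 2 P.mu}
    (hh : h ∈ P.E) (hne : h ≠ P.avgScalarLp - hΦ.mem.2.toLp Φ) :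
    ‖P.avgScalarLp - hΦ.mem.2.toLp Φ‖ < ‖h‖ := by
  refine lt_of_pow_lt_pow_left₀ 2 (norm_nonneg _) ?_
  rw [P.norm_sq_of_mem_E hΦ.sub_mem_E, P.norm_sq_of_mem_E hh]
  set φ := hΦ.mem.2.toLp Φ with hφ
  have h1 := P.mem_E_iff.1 hh Φ hΦ.mem
  rw [hΦ.scaling, ← P.norm_toLp_eq hΦ.mem.2, ← hφ] at h1
  have h2 : 0 < ‖h - P.avgScalarLp + φ‖ := by
    rw [norm_pos_iff]
    intro h0
    exact hne (by rw [← sub_eq_zero, ← h0]; abel)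
  have h3 := pow_pos h2 2
  rw [norm_add_sq_real] at h3
  rw [sub_sub_cancel_left, norm_neg]
  linarith

/-! ### The supremum as a distance -/

theorem isLUB_infDist : IsLUB {r : ℝ | ∃ f ∈ P.C1L2, P.norm2 f ≠ 0 ∧ r = -P.L f / P.norm2 f}
    (Metric.infDist P.avgScalarLp P.E) := by
  obtain ⟨M, hM0, hM⟩ := P.exists_neg_L_le
  obtain ⟨h, hh, -⟩ := P.exists_mem_E_norm_sub_le hM0 hM
  constructor
  · rintro _ ⟨f, hf, hf0, rfl⟩
    refine (Metric.le_infDist ⟨h, hh⟩).2 fun y hy => ?_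
    rw [dist_eq_norm, div_le_iff₀ ((P.norm2_nonneg f).lt_of_ne' hf0)]
    exact P.neg_L_le_of_mem_E hy hf
  · intro b hb
    -- The constant function `1` contributes the ratio `0`.
    have hb0 : 0 ≤ b := by
      refine hb ⟨_, P.const_mem_C1L2 1, ?_, by rw [L_const]; simp⟩
      have hne : P.mu Set.univ ≠ 0 := by simpa [mu] using P.measure_interior_pos.ne'
      rw [norm2, eLpNorm_const _ two_ne_zero (fun h0 => hne (by simp [h0]))]
      simp [ENNReal.toReal_eq_zero_iff, hne]
    obtain ⟨h', hh', hle⟩ := P.exists_mem_E_norm_sub_le hb0 fun f hf =>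
      P.neg_L_le_of_ratio_le (fun f hf hf0 => hb ⟨f, hf, hf0, rfl⟩) hf
    exact (Metric.infDist_le_dist_of_mem hh').trans (by rwa [dist_eq_norm])

end

end MomentPolytope

theorem mainTheorem2 {n : ℕ} (P : MomentPolytope n) :
    (∀ (Φ : EuclideanSpace ℝ (Fin n) → ℝ) (hΦ : P.IsOptimalDestabiliser Φ),
      P.avgScalarLp - hΦ.mem.2.toLp Φ ∈ P.E ∧
      ∀ h ∈ P.E, h ≠ P.avgScalarLp - hΦ.mem.2.toLp Φ →
        ‖P.avgScalarLp - hΦ.mem.2.toLp Φ‖ < ‖h‖) ∧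
    P.E.Nonempty ∧
    IsLUB {r : ℝ | ∃ f ∈ P.C1L2, P.norm2 f ≠ 0 ∧ r = -P.L f / P.norm2 f}
      (Metric.infDist P.avgScalarLp P.E) := by
  obtain ⟨M, hM0, hM⟩ := P.exists_neg_L_le
  obtain ⟨h, hh, -⟩ := P.exists_mem_E_norm_sub_le hM0 hM
  exact ⟨fun Φ hΦ => ⟨hΦ.sub_mem_E, fun h hh hne => hΦ.norm_lt hh hne⟩, ⟨h, hh⟩,
    P.isLUB_infDist⟩
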